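/- Let $\Gamma=(V,E)$ be a finite directed graph (loops and multiple edges are allowed), with $s(e)$ and $r(e)$ the source and the range of an edge $e$, and let $F$ be a field. A path is a sequence of edges $e_1\dots e_n$ with $r(e_i)=s(e_{i+1})$ for $1\le i<n$; vertices are regarded as paths of length $0$. If $n\ge 1$, $r(e_n)=s(e_1)$ and the vertices $s(e_1),\dots,s(e_n)$ are distinct, the subgraph $(\{s(e_1),\dots,s(e_n)\},\{e_1,\dots,e_n\})$ is called a cycle. Assume that no two distinct cycles of $\Gamma$ have a common vertex. Let $L(\Gamma)$ be the Leavitt path algebra, i.e. the associative (not necessarily unital) $F$-algebra presented by the generators $v$ $(v\in V)$, $e,e^*$ $(e\in E)$ and the relations (i) $vw=\delta_{v,w}v$ for $v,w\in V$; (ii) $s(e)e=e\,r(e)=e$ and $r(e)e^*=e^*s(e)=e^*$ for $e\in E$; (iii) $e^*f=\delta_{e,f}\,r(e)$ for $e,f\in E$; (iv) $v=\sum_{s(e)=v}ee^*$ for every vertex $v$ with $s^{-1}(v)\neq\varnothing$. Let $V_0$ be the set of vertices $v$ such that no path starting at $v$ (including the path of length $0$) ends at a vertex lying on a cycle, and let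 $I_0$ be the two-sided ideal of $L(\Gamma)$ generated by $V_0$. An algebra is called locally finite dimensional if each of its finitely generated (not necessarily unital) subalgebras is finite dimensional, and $\mathrm{Loc}(A)$ denotes the sum of all two-sided ideals of an algebra $A$ that are locally finite dimensional as algebras. Then $$I_0=\mathrm{Loc}(L(\Gamma)).$$ -/

import Mathlib

/-- A directed graph `Γ = (V, E)` (loops and multiple edges allowed), given by the source
and the range of every edge. -/
structure DirGraph (V : Type*) (E : Type*) where
  /-- the source of an edge -/
  s : E → V
  /-- the range of an edge -/
  r : E → V

namespace DirGraph

variable {V E : Type*}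

/-- `Γ.IsPath v p w`: the sequence of edges `p` is a path of `Γ` that starts at `v` and ends
at `w`.  Vertices are the paths of length zero. -/
def IsPath (Γ : DirGraph V E) : V → List E → V → Prop
  | v, [], w => v = w
  | v, e :: p, w => Γ.s e = v ∧ Γ.IsPath (Γ.r e) p w

/-- `Γ.IsCycle (W, D)`: the subgraph with vertex set `W` and edge set `D` is a cycle, that is,
it consists of the vertices and the edges of a closed path `e₁ … eₙ`, `n ≥ 1`, whose vertices
`s(e₁), …, s(eₙ)` are distinct. -/
def IsCycle (Γ : DirGraph V E) (C : Set V × Set E) : Prop :=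
  ∃ (v : V) (p : List E), p ≠ [] ∧ Γ.IsPath v p v ∧ (p.map Γ.s).Nodup ∧
    C = ({w | w ∈ p.map Γ.s}, {e | e ∈ p})

/-- No two distinct cycles of `Γ` intersect (have a common vertex). -/
def NoDistinctIntersectingCycles (Γ : DirGraph V E) : Prop :=
  ∀ C D : Set V × Set E, Γ.IsCycle C → Γ.IsCycle D → C ≠ D → Disjoint C.1 D.1

/-- The set `V₀` of the vertices `v` such that no path starting at `v` ends at a vertex that
lies on a cycle. -/
def V₀ (Γ : DirGraph V E) : Set V :=
  {v | ∀ (p : List E) (w : V), Γ.IsPath v p w →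
    ∀ C : Set V × Set E, Γ.IsCycle C → w ∉ C.1}

end DirGraph

section Algebra

variable (F : Type*) [Field F] {A : Type*} [NonUnitalRing A] [Module F A]

/-- A subspace of the (not necessarily unital) associative algebra `A` that is a two-sided
ideal. -/
def IsAlgIdeal (I : Submodule F A) : Prop :=
  ∀ (a x : A), x ∈ I → a * x ∈ I ∧ x * a ∈ I

/-- The two-sided ideal of `A` generated by a set: the smallest one that contains it. -/
def algIdealSpan (S : Set A) : Submodule F A :=
  sInf {I : Submodule F A | IsAlgIdeal F I ∧ S ⊆ I}

variable [IsScalarTower F A A] [SMulCommClass F A A]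

/-- The ideal `I`, as an algebra, is locally finite dimensional: each of its subalgebras (not
necessarily containing an identity element) generated by a finite set is finite dimensional. -/
def IsLocallyFiniteDimensional (I : Submodule F A) : Prop :=
  ∀ S : Set A, S.Finite → S ⊆ I → FiniteDimensional F (NonUnitalAlgebra.adjoin F S)

variable (A)

/-- The locally finite-dimensional radical `Loc(A)`: the sum of all locally finite-dimensional
two-sided ideals of `A`. -/
def Loc : Submodule F A :=
  sSup {I : Submodule F A | IsAlgIdeal F I ∧ IsLocallyFiniteDimensional F I}

end Algebra

namespace Leavitt

/-- The generators `v`, `e`, `e*` of the Leavitt path algebra. -/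
inductive Gen (V : Type*) (E : Type*)
  | vertex (v : V) : Gen V E
  | edge (e : E) : Gen V E
  | ghost (e : E) : Gen V E

/-- The free associative (non-unital) `F`-algebra on the generators: the semigroup algebra of
the free semigroup. -/
abbrev Free (F : Type*) [Field F] (V : Type*) (E : Type*) :=
  MonoidAlgebra F (FreeSemigroup (Gen V E))

section

variable (F : Type*) [Field F] {V E : Type*}

/-- A vertex, as an element of the free algebra. -/
noncomputable def fv (v : V) : Free F V E :=
  MonoidAlgebra.single (FreeSemigroup.of (Gen.vertex v)) 1

/-- An edge `e`, as an element of the free algebra. -/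
noncomputable def fe (e : E) : Free F V E :=
  MonoidAlgebra.single (FreeSemigroup.of (Gen.edge e)) 1

/-- A ghost edge `e*`, as an element of the free algebra. -/
noncomputable def fg (e : E) : Free F V E :=
  MonoidAlgebra.single (FreeSemigroup.of (Gen.ghost e)) 1

variable [Fintype E] (Γ : DirGraph V E)

open Classical in
/-- The defining relations of the Leavitt path algebra. -/
inductive Rel : Free F V E → Free F V E → Prop
  | vertex_mul (v w : V) : Rel (fv F v * fv F w) (if v = w then fv F v else 0)
  | src_mul_edge (e : E) : Rel (fv F (Γ.s e) * fe F e) (fe F e)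
  | edge_mul_rng (e : E) : Rel (fe F e * fv F (Γ.r e)) (fe F e)
  | rng_mul_ghost (e : E) : Rel (fv F (Γ.r e) * fg F e) (fg F e)
  | ghost_mul_src (e : E) : Rel (fg F e * fv F (Γ.s e)) (fg F e)
  | ghost_mul_edge (e f : E) : Rel (fg F e * fe F f) (if e = f then fv F (Γ.r e) else 0)
  | vertex_eq_sum (v : V) (hv : ∃ e, Γ.s e = v) :
      Rel (fv F v) (∑ e ∈ Finset.univ.filter (fun e => Γ.s e = v), fe F e * fg F e)

/-- The smallest congruence of the free `F`-algebra (a ring congruence compatible with the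
multiplication by scalars) that contains the defining relations. -/
noncomputable def con : RingCon (Free F V E) :=
  sInf {c | (∀ (k : F) (a b : Free F V E), c a b → c (k • a) (k • b)) ∧
    ∀ a b, Rel F Γ a b → c a b}

theorem con_smul (k : F) {a b : Free F V E} (h : con F Γ a b) :
    con F Γ (k • a) (k • b) :=
  fun c hc => hc.1 k a b (h c hc)

/-- The Leavitt path algebra `L(Γ)` over `F`: the associative algebra presented by the
generators `v`, `e`, `e*` and the defining relations. -/
def LPA : Type _ := (con F Γ).Quotient

noncomputable instance : NonUnitalRing (LPA F Γ) :=
  inferInstanceAs (NonUnitalRing (con F Γ).Quotient)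

/-- The class in `L(Γ)` of an element of the free algebra. -/
noncomputable def mk (a : Free F V E) : LPA F Γ :=
  RingCon.toQuotient (c := con F Γ) a

theorem mk_surjective : Function.Surjective (mk F Γ) := Quotient.exists_rep

theorem mk_add (a b : Free F V E) : mk F Γ (a + b) = mk F Γ a + mk F Γ b := rfl

theorem mk_mul (a b : Free F V E) : mk F Γ (a * b) = mk F Γ a * mk F Γ b := rfl

theorem mk_zero : mk F Γ 0 = 0 := rfl

noncomputable instance : SMul F (LPA F Γ) where
  smul k := Quotient.map' (k • ·) fun _ _ h => con_smul F Γ k h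

theorem mk_smul (k : F) (a : Free F V E) : mk F Γ (k • a) = k • mk F Γ a := rfl

noncomputable instance : Module F (LPA F Γ) where
  one_smul x := by
    obtain ⟨a, rfl⟩ := mk_surjective F Γ x
    rw [← mk_smul, one_smul]
  mul_smul k l x := by
    obtain ⟨a, rfl⟩ := mk_surjective F Γ x
    simp only [← mk_smul, mul_smul]
  smul_zero k := by
    rw [← mk_zero, ← mk_smul, smul_zero]
  smul_add k x y := by
    obtain ⟨a, rfl⟩ := mk_surjective F Γ x
    obtain ⟨b, rfl⟩ := mk_surjective F Γ y
    simp only [← mk_smul, ← mk_add, smul_add]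
  add_smul k l x := by
    obtain ⟨a, rfl⟩ := mk_surjective F Γ x
    simp only [← mk_smul, ← mk_add, add_smul]
  zero_smul x := by
    obtain ⟨a, rfl⟩ := mk_surjective F Γ x
    rw [← mk_smul, zero_smul, mk_zero]

instance : IsScalarTower F (LPA F Γ) (LPA F Γ) where
  smul_assoc k x y := by
    obtain ⟨a, rfl⟩ := mk_surjective F Γ x
    obtain ⟨b, rfl⟩ := mk_surjective F Γ y
    simp only [smul_eq_mul, ← mk_smul, ← mk_mul, smul_mul_assoc]

instance : SMulCommClass F (LPA F Γ) (LPA F Γ) where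
  smul_comm k x y := by
    obtain ⟨a, rfl⟩ := mk_surjective F Γ x
    obtain ⟨b, rfl⟩ := mk_surjective F Γ y
    simp only [smul_eq_mul, ← mk_smul, ← mk_mul, mul_smul_comm]

/-- The element of `L(Γ)` given by a vertex. -/
noncomputable def vertex (v : V) : LPA F Γ := mk F Γ (fv F v)

/-- The ideal `I₀` of `L(Γ)` generated by the vertices from which no path reaches a cycle. -/
noncomputable def I₀ : Submodule F (LPA F Γ) :=
  algIdealSpan F (vertex F Γ '' Γ.V₀)

end

end Leavitt

/-! `I₀` is locally finite dimensional: the graph below `V₀` is finite and acyclic, so relation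
(iv), applied repeatedly, writes each vertex of `V₀` through products `p q*` of paths ending at a
common sink. These products span an ideal and multiply like matrix units, so finitely many paths
span a finite dimensional subalgebra (`mul_mem_sinkSpan`, `I₀_le_sinkSpan`).

Conversely, let `x` lie in a locally finite dimensional ideal `J` but not in `I₀`. Multiplying by a
long path `q` to `w` removes all ghost edges while `x q` stays outside `I₀`; hence `w ∉ V₀`.
Stripping off the shortest path in `x q` gives `k w + h` with `k ≠ 0` and `h` made of paths of
positive length. Conjugation by a path from `w` to the base `u` of a closed path `c`, then
multiplication by `c`, gives `a = k c + c h'` in `J`. In a representation on functions of an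
infinite path and a degree, `a` raises degrees with leading part `k c`, so its powers are
independent (`not_finiteDimensional_adjoin`), a contradiction. -/

namespace DirGraph

/-! ### Paths, closed paths and the acyclic set `V₀`. -/

variable {V E : Type*} {Γ : DirGraph V E}

theorem IsPath.append {v w u : V} {p q : List E} (hp : Γ.IsPath v p w) (hq : Γ.IsPath w q u) :
    Γ.IsPath v (p ++ q) u := by
  induction p generalizing v with
  | nil => cases hp; exact hq
  | cons e p ih => exact ⟨hp.1, ih hp.2⟩

theorem IsPath.exists_of_append {v u : V} {p q : List E} (h : Γ.IsPath v (p ++ q) u) :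
    ∃ w, Γ.IsPath v p w ∧ Γ.IsPath w q u := by
  induction p generalizing v with
  | nil => exact ⟨v, rfl, h⟩
  | cons e p ih =>
    obtain ⟨w, h1, h2⟩ := ih h.2
    exact ⟨w, ⟨h.1, h1⟩, h2⟩

/-- A path either visits every source at most once or contains a cycle. -/
theorem IsPath.nodup_or_exists_cycle {v w : V} {p : List E} (hp : Γ.IsPath v p w) :
    (p.map Γ.s).Nodup ∨ ∃ (l : List E) (u : V) (c : List E), Γ.IsPath v l u ∧ c ≠ [] ∧
      Γ.IsPath u c u ∧ (c.map Γ.s).Nodup := by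
  induction p generalizing v with
  | nil => left; simp
  | cons e p ih =>
    obtain ⟨rfl, hp⟩ := hp
    rcases ih hp with h | ⟨l, u, c, hl, hc⟩
    -- If `s e` recurs in `p`, then `e` and the part of `p` before the recurrence form a closed
    -- path; its sources are distinct because those of `p` are.
    · by_cases he : Γ.s e ∈ p.map Γ.s
      · right
        obtain ⟨f, hf, hfe⟩ := List.mem_map.1 he
        obtain ⟨a, b, rfl⟩ := List.append_of_mem hf
        obtain ⟨x, hx, hx'⟩ := hp.exists_of_append
        have hx2 : Γ.s f = x := hx'.1
        refine ⟨[], Γ.s e, e :: a, rfl, by simp, ⟨rfl, ?_⟩, ?_⟩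
        · rw [← hfe, hx2]; exact hx
        · rw [List.map_append, List.nodup_append] at h
          rw [List.map_cons, List.nodup_cons]
          refine ⟨fun hm => ?_, h.1⟩
          exact h.2.2 _ hm (Γ.s f) (by simp) hfe.symm
      · left
        rw [List.map_cons, List.nodup_cons]
        exact ⟨he, h⟩
    · exact .inr ⟨e :: l, u, c, ⟨rfl, hl⟩, hc⟩

theorem IsPath.mem_map_s {v w : V} {p : List E} (hp : Γ.IsPath v p w) (hne : p ≠ []) :
    v ∈ p.map Γ.s := by
  cases p with
  | nil => exact absurd rfl hne
  | cons e p => simp [← hp.1]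

theorem V₀_closed {v w : V} {p : List E} (hv : v ∈ Γ.V₀) (hp : Γ.IsPath v p w) : w ∈ Γ.V₀ :=
  fun _ u hq => hv _ u (hp.append hq)

theorem not_closed_of_mem_V₀ {v : V} {p : List E} (hv : v ∈ Γ.V₀) (hp : Γ.IsPath v p v) :
    p = [] := by
  by_contra hne
  obtain ⟨l, u, c, hl, hc, hcu, hd⟩ : ∃ (l : List E) (u : V) (c : List E), Γ.IsPath v l u ∧
      c ≠ [] ∧ Γ.IsPath u c u ∧ (c.map Γ.s).Nodup := by
    rcases hp.nodup_or_exists_cycle with h | h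
    · exact ⟨[], v, p, rfl, hne, hp, h⟩
    · exact h
  exact hv l u hl _ ⟨u, c, hc, hcu, hd, rfl⟩ (hcu.mem_map_s hc)

theorem r_mem_V₀ {e : E} (h : Γ.s e ∈ Γ.V₀) : Γ.r e ∈ Γ.V₀ :=
  V₀_closed (p := [e]) h ⟨rfl, rfl⟩

/-- A vertex outside `V₀` is connected to the base point of a closed path. -/
theorem exists_closed_of_notMem_V₀ {v : V} (hv : v ∉ Γ.V₀) :
    ∃ (g : List E) (u : V) (c : List E), Γ.IsPath v g u ∧ c ≠ [] ∧ Γ.IsPath u c u ∧ u ∉ Γ.V₀ := by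
  simp only [V₀, Set.mem_ofPred_eq, not_forall, not_not] at hv
  obtain ⟨g, u, hg, C, hC, hu⟩ := hv
  have hu₀ : u ∉ Γ.V₀ := fun h => h [] u rfl C hC hu
  obtain ⟨x, p, hp, hx, -, rfl⟩ := hC
  obtain ⟨e, he, rfl⟩ := List.mem_map.1 hu
  obtain ⟨a, b, rfl⟩ := List.append_of_mem he
  obtain ⟨y, hy, hy'⟩ := hx.exists_of_append
  obtain rfl : Γ.s e = y := hy'.1
  -- The cycle is based at `x`; rotating it moves the base point to `Γ.s e`.
  exact ⟨g, Γ.s e, e :: b ++ a, hg, by simp, hy'.append hy, hu₀⟩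

theorem exists_edge_of_notMem_V₀ {v : V} (hv : v ∉ Γ.V₀) :
    ∃ e, Γ.s e = v ∧ Γ.r e ∉ Γ.V₀ := by
  obtain ⟨g, u, c, hg, hc, hu, hu₀⟩ := exists_closed_of_notMem_V₀ hv
  cases g with
  | cons e g => exact ⟨e, hg.1, fun h => hu₀ (V₀_closed h hg.2)⟩
  | nil =>
    obtain rfl : v = u := hg
    cases c with
    | nil => exact absurd rfl hc
    | cons e c => exact ⟨e, hu.1, fun h => hv (V₀_closed h hu.2)⟩

/-- Induction along the edges inside `V₀`, where the graph is acyclic. -/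
theorem V₀_induction [Finite V] {P : V → Prop}
    (h : ∀ v ∈ Γ.V₀, (∀ e, Γ.s e = v → P (Γ.r e)) → P v) : ∀ v ∈ Γ.V₀, P v := by
  -- Reachability by a nonempty path is transitive, and irreflexive on `V₀` by acyclicity; on a
  -- finite set this makes it well-founded.
  let R : Γ.V₀ → Γ.V₀ → Prop := fun w v => ∃ p : List E, p ≠ [] ∧ Γ.IsPath v.1 p w.1
  have : IsTrans _ R := ⟨fun a b c ⟨p, hp, h1⟩ ⟨q, _, h2⟩ => ⟨q ++ p, by simp [hp], h2.append h1⟩⟩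
  have : Std.Irrefl R := ⟨fun a ⟨p, hp, h1⟩ => hp (not_closed_of_mem_V₀ a.2 h1)⟩
  have wf : WellFounded R := Finite.wellFounded_of_trans_of_irrefl R
  have key : ∀ v : Γ.V₀, P v.1 := fun v => wf.induction (C := fun v => P v.1) v fun v ih =>
    h v.1 v.2 fun e he =>
      ih ⟨Γ.r e, r_mem_V₀ (he ▸ v.2)⟩ ⟨[e], by simp, he, rfl⟩
  exact fun v hv => key ⟨v, hv⟩

/-! ### Infinite paths. -/

/-- The sequence of edges `x` is an infinite path. -/
def IsInfPath (Γ : DirGraph V E) (x : Stream' E) : Prop :=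
  ∀ n, Γ.r (x.get n) = Γ.s (x.get (n + 1))

theorem isInfPath_cons {e : E} {x : Stream' E} :
    Γ.IsInfPath (x.cons e) ↔ Γ.IsInfPath x ∧ Γ.s x.head = Γ.r e := by
  constructor
  · intro h
    exact ⟨fun n => h (n + 1), (h 0).symm⟩
  · rintro ⟨h, he⟩ n
    cases n with
    | zero => exact he.symm
    | succ n => exact h n

theorem isInfPath_tail {x : Stream' E} (h : Γ.IsInfPath x) :
    Γ.IsInfPath x.tail ∧ Γ.s x.tail.head = Γ.r x.head := by
  rw [← isInfPath_cons, Stream'.eta]; exact h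

theorem exists_isInfPath {v : V} (hv : v ∉ Γ.V₀) : ∃ x, Γ.IsInfPath x ∧ Γ.s x.head = v := by
  have h : ∀ v : {v // v ∉ Γ.V₀}, ∃ e, Γ.s e = v.1 ∧ Γ.r e ∉ Γ.V₀ :=
    fun v => exists_edge_of_notMem_V₀ v.2
  choose f hf hf' using h
  let g : {v // v ∉ Γ.V₀} → {v // v ∉ Γ.V₀} := fun v => ⟨Γ.r (f v), hf' v⟩
  refine ⟨fun n => f (g^[n] ⟨v, hv⟩), fun n => ?_, hf _⟩
  change Γ.r (f (g^[n] ⟨v, hv⟩)) = Γ.s (f (g^[n + 1] ⟨v, hv⟩))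
  rw [hf, Function.iterate_succ_apply']

end DirGraph

/-! ### Generated ideals and products with spans. -/

theorem isAlgIdeal_algIdealSpan (F : Type*) [Field F] {A : Type*} [NonUnitalRing A] [Module F A]
    (S : Set A) : IsAlgIdeal F (algIdealSpan F S) := by
  intro a x hx
  simp only [algIdealSpan, Submodule.mem_sInf] at hx ⊢
  exact ⟨fun I hI => (hI.1 a x (hx I hI)).1, fun I hI => (hI.1 a x (hx I hI)).2⟩

theorem subset_algIdealSpan (F : Type*) [Field F] {A : Type*} [NonUnitalRing A] [Module F A]
    (S : Set A) : S ⊆ algIdealSpan F S := by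
  intro x hx
  simp only [algIdealSpan, SetLike.mem_coe, Submodule.mem_sInf]
  exact fun I hI => hI.2 hx

theorem mul_mem_of_mem_span {F A : Type*} [Field F] [NonUnitalRing A] [Module F A]
    [SMulCommClass F A A] {S : Set A} {N : Submodule F A} {a x : A} (h : ∀ s ∈ S, a * s ∈ N)
    (hx : x ∈ Submodule.span F S) : a * x ∈ N := by
  induction hx using Submodule.span_induction with
  | mem s hs => exact h s hs
  | zero => rw [mul_zero]; exact zero_mem _
  | add x y _ _ h1 h2 => rw [mul_add]; exact add_mem h1 h2
  | smul k x _ h => rw [mul_smul_comm]; exact Submodule.smul_mem _ _ h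

theorem mul_mem_of_mem_span_left {F A : Type*} [Field F] [NonUnitalRing A] [Module F A]
    [IsScalarTower F A A] {S : Set A} {N : Submodule F A} {a x : A} (h : ∀ s ∈ S, s * a ∈ N)
    (hx : x ∈ Submodule.span F S) : x * a ∈ N := by
  induction hx using Submodule.span_induction with
  | mem s hs => exact h s hs
  | zero => rw [zero_mul]; exact zero_mem _
  | add x y _ _ h1 h2 => rw [add_mul]; exact add_mem h1 h2
  | smul k x _ h => rw [smul_mul_assoc]; exact Submodule.smul_mem _ _ h

/-! ### Multiplication rules for paths and ghost paths in `L(Γ)`. -/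

namespace Leavitt

variable (F : Type*) [Field F] {V E : Type*} [Fintype E] (Γ : DirGraph V E)

/-- The element of `L(Γ)` given by an edge. -/
noncomputable def edge (e : E) : LPA F Γ := mk F Γ (fe F e)

/-- The element of `L(Γ)` given by a ghost edge. -/
noncomputable def ghost (e : E) : LPA F Γ := mk F Γ (fg F e)

theorem mk_eq_of_rel {a b : Free F V E} (h : Rel F Γ a b) : mk F Γ a = mk F Γ b :=
  (RingCon.eq (con F Γ)).2 fun _ hc => hc.2 a b h

open Classical in
theorem vertex_mul_vertex (v w : V) :
    vertex F Γ v * vertex F Γ w = if v = w then vertex F Γ v else 0 := by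
  have := mk_eq_of_rel F Γ (Rel.vertex_mul v w)
  split_ifs at this ⊢ <;> exact this

theorem vertex_mul_self (v : V) : vertex F Γ v * vertex F Γ v = vertex F Γ v := by
  rw [vertex_mul_vertex, if_pos rfl]

theorem vertex_mul_of_ne {v w : V} (h : v ≠ w) : vertex F Γ v * vertex F Γ w = 0 := by
  rw [vertex_mul_vertex, if_neg h]

theorem src_mul_edge (e : E) : vertex F Γ (Γ.s e) * edge F Γ e = edge F Γ e :=
  mk_eq_of_rel F Γ (Rel.src_mul_edge e)

theorem edge_mul_rng (e : E) : edge F Γ e * vertex F Γ (Γ.r e) = edge F Γ e :=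
  mk_eq_of_rel F Γ (Rel.edge_mul_rng e)

theorem rng_mul_ghost (e : E) : vertex F Γ (Γ.r e) * ghost F Γ e = ghost F Γ e :=
  mk_eq_of_rel F Γ (Rel.rng_mul_ghost e)

theorem ghost_mul_src (e : E) : ghost F Γ e * vertex F Γ (Γ.s e) = ghost F Γ e :=
  mk_eq_of_rel F Γ (Rel.ghost_mul_src e)

theorem ghost_mul_edge_self (e : E) : ghost F Γ e * edge F Γ e = vertex F Γ (Γ.r e) := by
  have := mk_eq_of_rel F Γ (Rel.ghost_mul_edge e e)
  rwa [if_pos rfl] at this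

theorem ghost_mul_edge_of_ne {e f : E} (h : e ≠ f) : ghost F Γ e * edge F Γ f = 0 := by
  have := mk_eq_of_rel F Γ (Rel.ghost_mul_edge e f)
  rwa [if_neg h] at this

theorem vertex_mul_edge_of_ne {v : V} {e : E} (h : v ≠ Γ.s e) :
    vertex F Γ v * edge F Γ e = 0 := by
  rw [← src_mul_edge, ← mul_assoc, vertex_mul_of_ne F Γ h, zero_mul]

theorem ghost_mul_vertex_of_ne {v : V} {e : E} (h : Γ.s e ≠ v) :
    ghost F Γ e * vertex F Γ v = 0 := by
  rw [← ghost_mul_src, mul_assoc, vertex_mul_of_ne F Γ h, mul_zero]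

/-- The quotient map as a linear map. -/
noncomputable def mkₗ : Free F V E →ₗ[F] LPA F Γ where
  toFun := mk F Γ
  map_add' := mk_add F Γ
  map_smul' := mk_smul F Γ

open Classical in
theorem vertex_eq_sum {v : V} (hv : ∃ e, Γ.s e = v) :
    vertex F Γ v = ∑ e ∈ Finset.univ.filter (fun e => Γ.s e = v), edge F Γ e * ghost F Γ e := by
  have := mk_eq_of_rel F Γ (Rel.vertex_eq_sum v hv)
  exact this.trans (map_sum (mkₗ F Γ) _ _)

variable {F Γ} in
theorem LPA.induction {P : LPA F Γ → Prop} (vertex : ∀ v, P (vertex F Γ v))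
    (edge : ∀ e, P (edge F Γ e)) (ghost : ∀ e, P (ghost F Γ e))
    (zero : P 0) (add : ∀ x y, P x → P y → P (x + y)) (smul : ∀ (k : F) x, P x → P (k • x))
    (mul : ∀ x y, P x → P y → P (x * y)) (x : LPA F Γ) : P x := by
  have gen : ∀ g : Gen V E, P (mk F Γ (MonoidAlgebra.single (FreeSemigroup.of g) 1)) := by
    rintro (v | e | e)
    exacts [vertex v, edge e, ghost e]
  have word : ∀ w : FreeSemigroup (Gen V E), P (mk F Γ (MonoidAlgebra.single w 1)) := by
    intro w
    induction w using FreeSemigroup.recOnMul with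
    | ih1 g => exact gen g
    | ih2 g w h1 h2 =>
      have : (MonoidAlgebra.single (FreeSemigroup.of g * w) 1 : Free F V E) =
          MonoidAlgebra.single (FreeSemigroup.of g) 1 * MonoidAlgebra.single w 1 := by
        rw [MonoidAlgebra.single_mul_single, one_mul]
      rw [this, mk_mul]
      exact mul _ _ h1 h2
  obtain ⟨a, rfl⟩ := mk_surjective F Γ x
  have ha : a ∈ Submodule.span F
      (Set.range fun w => (MonoidAlgebra.single w 1 : Free F V E)) := by
    induction a using MonoidAlgebra.induction_linear with
    | zero => exact zero_mem _
    | add f g hf hg => exact add_mem hf hg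
    | single w k =>
      have : (MonoidAlgebra.single w k : Free F V E) = k • MonoidAlgebra.single w 1 := by
        simp
      rw [this]
      exact Submodule.smul_mem _ _ (Submodule.subset_span ⟨w, rfl⟩)
  induction ha using Submodule.span_induction with
  | mem _ h => obtain ⟨w, rfl⟩ := h; exact word w
  | zero => exact zero
  | add x y _ _ hx hy => exact add _ _ hx hy
  | smul k x _ hx => exact smul k _ hx

/-- The product of the edges of `p` and the vertex `w`. -/
noncomputable def pathTo : List E → V → LPA F Γ
  | [], w => vertex F Γ w
  | e :: p, w => edge F Γ e * pathTo p w

/-- The product of the vertex `w` and the ghost edges of `p` in the reverse order. -/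
noncomputable def ghostFrom : List E → V → LPA F Γ
  | [], w => vertex F Γ w
  | e :: p, w => ghostFrom p w * ghost F Γ e

variable {F Γ}

theorem vertex_mul_pathTo (v : V) (p : List E) (w : V) :
    vertex F Γ v * pathTo F Γ p w = pathTo F Γ p w ∨ vertex F Γ v * pathTo F Γ p w = 0 := by
  cases p with
  | nil =>
    by_cases h : v = w
    · subst h; exact .inl (vertex_mul_self F Γ v)
    · exact .inr (vertex_mul_of_ne F Γ h)
  | cons e p =>
    simp only [pathTo, ← mul_assoc]
    by_cases h : v = Γ.s e
    · subst h; left; rw [src_mul_edge]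
    · right; rw [vertex_mul_edge_of_ne F Γ h, zero_mul]

theorem ghostFrom_mul_vertex (v : V) (p : List E) (w : V) :
    ghostFrom F Γ p w * vertex F Γ v = ghostFrom F Γ p w ∨
      ghostFrom F Γ p w * vertex F Γ v = 0 := by
  cases p with
  | nil =>
    by_cases h : w = v
    · subst h; exact .inl (vertex_mul_self F Γ w)
    · exact .inr (vertex_mul_of_ne F Γ h)
  | cons e p =>
    simp only [ghostFrom, mul_assoc]
    by_cases h : Γ.s e = v
    · subst h; left; rw [ghost_mul_src]
    · right; rw [ghost_mul_vertex_of_ne F Γ h, mul_zero]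

theorem pathTo_mul_vertex (p : List E) (w : V) :
    pathTo F Γ p w * vertex F Γ w = pathTo F Γ p w := by
  induction p with
  | nil => exact vertex_mul_self F Γ w
  | cons e p ih => rw [pathTo, mul_assoc, ih]

theorem vertex_mul_ghostFrom (p : List E) (w : V) :
    vertex F Γ w * ghostFrom F Γ p w = ghostFrom F Γ p w := by
  induction p with
  | nil => exact vertex_mul_self F Γ w
  | cons e p ih => rw [ghostFrom, ← mul_assoc, ih]

theorem src_mul_pathTo {v w : V} {p : List E} (h : Γ.IsPath v p w) :
    vertex F Γ v * pathTo F Γ p w = pathTo F Γ p w := by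
  cases p with
  | nil => obtain rfl : v = w := h; exact vertex_mul_self F Γ v
  | cons e p => obtain ⟨rfl, -⟩ := h; rw [pathTo, ← mul_assoc, src_mul_edge]

theorem pathTo_mul_pathTo {v w : V} {q : List E} (h : Γ.IsPath v q w) (p : List E) :
    pathTo F Γ p v * pathTo F Γ q w = pathTo F Γ (p ++ q) w := by
  induction p with
  | nil => exact src_mul_pathTo h
  | cons e p ih => rw [pathTo, mul_assoc, ih]; rfl

theorem ghost_mul_pathTo_cons (f e : E) (p : List E) (w : V) :
    ghost F Γ f * pathTo F Γ (e :: p) w = pathTo F Γ p w ∨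
      ghost F Γ f * pathTo F Γ (e :: p) w = 0 := by
  rw [pathTo, ← mul_assoc]
  by_cases h : f = e
  · subst h
    rw [ghost_mul_edge_self]
    exact vertex_mul_pathTo _ _ _
  · right; rw [ghost_mul_edge_of_ne F Γ h, zero_mul]

theorem ghostFrom_cons_mul_edge (f e : E) (p : List E) (w : V) :
    ghostFrom F Γ (e :: p) w * edge F Γ f = ghostFrom F Γ p w ∨
      ghostFrom F Γ (e :: p) w * edge F Γ f = 0 := by
  rw [ghostFrom, mul_assoc]
  by_cases h : e = f
  · subst h
    rw [ghost_mul_edge_self]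
    exact ghostFrom_mul_vertex _ _ _
  · right; rw [ghost_mul_edge_of_ne F Γ h, mul_zero]

theorem ghostFrom_mul_pathTo_self {p : List E} {v w : V} (h : Γ.IsPath v p w) :
    ghostFrom F Γ p w * pathTo F Γ p w = vertex F Γ w := by
  induction p generalizing v with
  | nil => exact vertex_mul_self F Γ w
  | cons e p ih =>
    rw [pathTo, ghostFrom, mul_assoc, ← mul_assoc (ghost F Γ e), ghost_mul_edge_self,
      src_mul_pathTo h.2, ih h.2]

/-- Consecutive edges that do not match multiply to zero. This is why the spans below may range over
arbitrary lists of edges. -/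
theorem exists_isPath_of_pathTo_ne_zero {p : List E} {w : V} (h : pathTo F Γ p w ≠ 0) :
    ∃ v, Γ.IsPath v p w := by
  induction p with
  | nil => exact ⟨w, rfl⟩
  | cons e p ih =>
    obtain ⟨v, hv⟩ := ih fun h0 => h (by rw [pathTo, h0, mul_zero])
    by_cases hev : Γ.r e = v
    · exact ⟨Γ.s e, rfl, hev ▸ hv⟩
    · refine absurd ?_ h
      rw [pathTo, ← src_mul_pathTo hv, ← edge_mul_rng, mul_assoc, ← mul_assoc (vertex F Γ _),
        vertex_mul_of_ne F Γ hev, zero_mul, mul_zero]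

/-- Equal leading edges cancel in pairs and a mismatch gives zero. If all of `q` cancels, what
remains of `p` is nonempty since `q ≠ p`. -/
theorem ghostFrom_mul_pathTo_of_ne {q p : List E} (u w : V) (hl : q.length ≤ p.length)
    (hne : q ≠ p) : ghostFrom F Γ q u * pathTo F Γ p w = 0 ∨
      ∃ p', 0 < p'.length ∧ ghostFrom F Γ q u * pathTo F Γ p w = pathTo F Γ p' w := by
  induction q generalizing p with
  | nil =>
    rcases vertex_mul_pathTo (F := F) (Γ := Γ) u p w with h | h
    · exact .inr ⟨p, List.length_pos_iff.2 hne.symm, h⟩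
    · exact .inl h
  | cons e q ih =>
    cases p with
    | nil => simp at hl
    | cons f p =>
      rw [ghostFrom, mul_assoc]
      by_cases hef : e = f
      · subst hef
        rcases ghost_mul_pathTo_cons (F := F) (Γ := Γ) e e p w with h | h
        · rw [h]
          exact ih (by simpa using hl) (fun h => hne (by rw [h]))
        · left; rw [h, mul_zero]
      · left
        rw [pathTo, ← mul_assoc (ghost F Γ e), ghost_mul_edge_of_ne F Γ hef, zero_mul, mul_zero]

/-- After cancellation, a leftover edge or ghost edge would meet a sink and vanish, so only complete
cancellation survives. This is the matrix unit rule. -/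
theorem ghostFrom_mul_pathTo_of_sink {u w : V} (hu : ∀ e, Γ.s e ≠ u) (hw : ∀ e, Γ.s e ≠ w)
    (q p : List E) : ghostFrom F Γ q u * pathTo F Γ p w = 0 ∨
      u = w ∧ ghostFrom F Γ q u * pathTo F Γ p w = vertex F Γ w := by
  induction q generalizing p with
  | nil =>
    cases p with
    | nil =>
      by_cases h : u = w
      · subst h; exact .inr ⟨rfl, vertex_mul_self F Γ u⟩
      · exact .inl (vertex_mul_of_ne F Γ h)
    | cons e p =>
      left
      rw [ghostFrom, pathTo, ← mul_assoc, vertex_mul_edge_of_ne F Γ (hu e).symm, zero_mul]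
  | cons e q ih =>
    cases p with
    | nil =>
      left
      rw [ghostFrom, pathTo, mul_assoc, ghost_mul_vertex_of_ne F Γ (hw e), mul_zero]
    | cons f p =>
      rw [ghostFrom, mul_assoc]
      rcases ghost_mul_pathTo_cons (F := F) (Γ := Γ) e f p w with h | h
      · rw [h]; exact ih p
      · left; rw [h, mul_zero]

end Leavitt

/-! ### `I₀` is locally finite dimensional. -/

namespace Leavitt

variable {F : Type*} [Field F] {V E : Type*} [Fintype E] {Γ : DirGraph V E}

variable (F Γ) in
/-- The span of the elements `p q*`, where the paths `p` and `q` belong to `L` and end at the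
same sink. -/
noncomputable def sinkSpan (L : Set (List E)) : Submodule F (LPA F Γ) :=
  Submodule.span F {x | ∃ p ∈ L, ∃ q ∈ L, ∃ w, (∀ e, Γ.s e ≠ w) ∧
    x = pathTo F Γ p w * ghostFrom F Γ q w}

theorem mem_sinkSpan {L : Set (List E)} {p q : List E} {w : V} (hp : p ∈ L) (hq : q ∈ L)
    (hw : ∀ e, Γ.s e ≠ w) : pathTo F Γ p w * ghostFrom F Γ q w ∈ sinkSpan F Γ L :=
  Submodule.subset_span ⟨p, hp, q, hq, w, hw, rfl⟩

theorem sinkSpan_mono {L M : Set (List E)} (h : L ⊆ M) : sinkSpan F Γ L ≤ sinkSpan F Γ M :=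
  Submodule.span_mono fun _ ⟨p, hp, q, hq, w, hw, hx⟩ => ⟨p, h hp, q, h hq, w, hw, hx⟩

/-- The inner factor `q* p'` is zero or a vertex, so a product only involves outer paths already in
`L`. -/
theorem mul_mem_sinkSpan {L : Set (List E)} {x y : LPA F Γ} (hx : x ∈ sinkSpan F Γ L)
    (hy : y ∈ sinkSpan F Γ L) : x * y ∈ sinkSpan F Γ L := by
  refine mul_mem_of_mem_span_left ?_ hx
  rintro _ ⟨p, hp, q, hq, w, hw, rfl⟩
  refine mul_mem_of_mem_span ?_ hy
  rintro _ ⟨p', hp', q', hq', w', hw', rfl⟩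
  rw [mul_assoc, ← mul_assoc (ghostFrom F Γ q w)]
  rcases ghostFrom_mul_pathTo_of_sink (F := F) hw hw' q p' with h | ⟨rfl, h⟩
  · rw [h, zero_mul, mul_zero]; exact zero_mem _
  · rw [h, vertex_mul_ghostFrom]; exact mem_sinkSpan hp hq' hw

theorem finiteDimensional_sinkSpan [Finite V] {L : Set (List E)} (hL : L.Finite) :
    FiniteDimensional F (sinkSpan F Γ L) := by
  have h : Set.Finite ((fun t : List E × List E × V =>
      pathTo F Γ t.1 t.2.2 * ghostFrom F Γ t.2.1 t.2.2) '' (L ×ˢ L ×ˢ Set.univ)) :=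
    (hL.prod (hL.prod Set.finite_univ)).image _
  refine FiniteDimensional.span_of_finite F (h.subset ?_)
  rintro _ ⟨p, hp, q, hq, w, -, rfl⟩
  exact ⟨(p, q, w), ⟨hp, hq, trivial⟩, rfl⟩

theorem exists_finite_mem_sinkSpan {x : LPA F Γ} (hx : x ∈ sinkSpan F Γ Set.univ) :
    ∃ L : Set (List E), L.Finite ∧ x ∈ sinkSpan F Γ L := by
  induction hx using Submodule.span_induction with
  | mem _ h =>
    obtain ⟨p, -, q, -, w, hw, rfl⟩ := h
    exact ⟨{p, q}, by simp, mem_sinkSpan (by simp) (by simp) hw⟩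
  | zero => exact ⟨∅, Set.finite_empty, zero_mem _⟩
  | add x y _ _ hx hy =>
    obtain ⟨L, hL, hx⟩ := hx
    obtain ⟨M, hM, hy⟩ := hy
    exact ⟨L ∪ M, hL.union hM, add_mem (sinkSpan_mono Set.subset_union_left hx)
      (sinkSpan_mono Set.subset_union_right hy)⟩
  | smul k x _ hx =>
    obtain ⟨L, hL, hx⟩ := hx
    exact ⟨L, hL, Submodule.smul_mem _ _ hx⟩

theorem exists_finite_subset_sinkSpan {S : Set (LPA F Γ)} (hS : S.Finite)
    (hx : S ⊆ sinkSpan F Γ Set.univ) :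
    ∃ L : Set (List E), L.Finite ∧ S ⊆ sinkSpan F Γ L := by
  choose! f hf hf' using fun x (h : x ∈ S) => exists_finite_mem_sinkSpan (hx h)
  exact ⟨⋃ x ∈ S, f x, hS.biUnion hf, fun x h =>
    sinkSpan_mono (Set.subset_biUnion_of_mem (u := f) h) (hf' x h)⟩

/-- A generator times a path to a sink is again such a path or zero: the one doubtful case, a ghost
edge times the trivial path, vanishes as no edge leaves the sink. The right side is symmetric. -/
theorem isAlgIdeal_sinkSpan : IsAlgIdeal F (sinkSpan F Γ Set.univ) := by
  intro a x hx
  constructor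
  · revert x
    suffices h : ∀ (p q : List E) (w : V), (∀ e, Γ.s e ≠ w) →
        a * (pathTo F Γ p w * ghostFrom F Γ q w) ∈ sinkSpan F Γ Set.univ by
      intro x hx
      refine mul_mem_of_mem_span ?_ hx
      rintro _ ⟨p, -, q, -, w, hw, rfl⟩
      exact h p q w hw
    suffices h : ∀ (w : V), (∀ e, Γ.s e ≠ w) → ∀ p : List E, a * pathTo F Γ p w ∈
        Submodule.span F (Set.range fun p => pathTo F Γ p w) by
      intro p q w hw
      rw [← mul_assoc]
      refine mul_mem_of_mem_span_left ?_ (h w hw p)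
      rintro _ ⟨p, rfl⟩
      exact mem_sinkSpan trivial trivial hw
    intro w hw
    have hsub : ∀ p, pathTo F Γ p w ∈ Submodule.span F (Set.range fun p => pathTo F Γ p w) :=
      fun p => Submodule.subset_span ⟨p, rfl⟩
    induction a using LPA.induction with
    | vertex v =>
      intro p
      rcases vertex_mul_pathTo (F := F) (Γ := Γ) v p w with h | h <;> rw [h]
      exacts [hsub p, zero_mem _]
    | edge e => exact fun p => hsub (e :: p)
    | ghost e =>
      intro p
      cases p with
      | nil => rw [pathTo, ghost_mul_vertex_of_ne F Γ (hw e)]; exact zero_mem _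
      | cons f p =>
        rcases ghost_mul_pathTo_cons (F := F) (Γ := Γ) e f p w with h | h <;> rw [h]
        exacts [hsub p, zero_mem _]
    | zero => intro p; rw [zero_mul]; exact zero_mem _
    | add x y hx hy => intro p; rw [add_mul]; exact add_mem (hx p) (hy p)
    | smul k x hx => intro p; rw [smul_mul_assoc]; exact Submodule.smul_mem _ _ (hx p)
    | mul x y hx hy =>
      intro p
      rw [mul_assoc]
      refine mul_mem_of_mem_span ?_ (hy p)
      rintro _ ⟨p, rfl⟩
      exact hx p
  · revert x
    suffices h : ∀ (p q : List E) (w : V), (∀ e, Γ.s e ≠ w) →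
        pathTo F Γ p w * ghostFrom F Γ q w * a ∈ sinkSpan F Γ Set.univ by
      intro x hx
      refine mul_mem_of_mem_span_left ?_ hx
      rintro _ ⟨p, -, q, -, w, hw, rfl⟩
      exact h p q w hw
    suffices h : ∀ (w : V), (∀ e, Γ.s e ≠ w) → ∀ q : List E, ghostFrom F Γ q w * a ∈
        Submodule.span F (Set.range fun q => ghostFrom F Γ q w) by
      intro p q w hw
      rw [mul_assoc]
      refine mul_mem_of_mem_span ?_ (h w hw q)
      rintro _ ⟨q, rfl⟩
      exact mem_sinkSpan trivial trivial hw
    intro w hw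
    have hsub : ∀ q, ghostFrom F Γ q w ∈
        Submodule.span F (Set.range fun q => ghostFrom F Γ q w) :=
      fun q => Submodule.subset_span ⟨q, rfl⟩
    induction a using LPA.induction with
    | vertex v =>
      intro q
      rcases ghostFrom_mul_vertex (F := F) (Γ := Γ) v q w with h | h <;> rw [h]
      exacts [hsub q, zero_mem _]
    | ghost e => exact fun q => hsub (e :: q)
    | edge e =>
      intro q
      cases q with
      | nil => rw [ghostFrom, vertex_mul_edge_of_ne F Γ (hw e).symm]; exact zero_mem _
      | cons f q =>
        rcases ghostFrom_cons_mul_edge (F := F) (Γ := Γ) e f q w with h | h <;> rw [h]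
        exacts [hsub q, zero_mem _]
    | zero => intro q; rw [mul_zero]; exact zero_mem _
    | add x y hx hy => intro q; rw [mul_add]; exact add_mem (hx q) (hy q)
    | smul k x hx => intro q; rw [mul_smul_comm]; exact Submodule.smul_mem _ _ (hx q)
    | mul x y hx hy =>
      intro q
      rw [← mul_assoc]
      refine mul_mem_of_mem_span_left ?_ (hx q)
      rintro _ ⟨q, rfl⟩
      exact hy q

/-- Relation (iv) gives `v = ∑ e r(e) e*`, which passes from `v` to the ranges of its edges; a sink
is itself the product of two trivial paths. -/
theorem vertex_mem_sinkSpan [Finite V] : ∀ v ∈ Γ.V₀, vertex F Γ v ∈ sinkSpan F Γ Set.univ := by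
  classical
  refine DirGraph.V₀_induction fun v _ ih => ?_
  by_cases hs : ∃ e, Γ.s e = v
  · rw [vertex_eq_sum F Γ hs]
    refine sum_mem fun e he => ?_
    have := ih e (Finset.mem_filter.1 he).2
    rw [← edge_mul_rng]
    exact (isAlgIdeal_sinkSpan _ _ (isAlgIdeal_sinkSpan _ _ this).1).2
  · rw [← vertex_mul_self]
    exact mem_sinkSpan (p := []) (q := []) trivial trivial (by simpa using hs)

theorem I₀_le_sinkSpan [Finite V] : I₀ F Γ ≤ sinkSpan F Γ Set.univ := by
  refine sInf_le ⟨isAlgIdeal_sinkSpan, ?_⟩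
  rintro _ ⟨v, hv, rfl⟩
  exact vertex_mem_sinkSpan v hv

theorem isLocallyFiniteDimensional_I₀ [Finite V] : IsLocallyFiniteDimensional F (I₀ F Γ) := by
  intro S hS hSI
  obtain ⟨L, hL, hSL⟩ := exists_finite_subset_sinkSpan hS (hSI.trans I₀_le_sinkSpan)
  have := finiteDimensional_sinkSpan (F := F) (Γ := Γ) hL
  -- The generators involve only the finite set `L` of paths, so the algebra they generate stays
  -- inside this finite dimensional one.
  let B : NonUnitalSubalgebra F (LPA F Γ) :=
    { sinkSpan F Γ L with mul_mem' := mul_mem_sinkSpan }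
  have hB : NonUnitalAlgebra.adjoin F S ≤ B := NonUnitalAlgebra.adjoin_le hSL
  exact Submodule.finiteDimensional_of_le
    (S₁ := (NonUnitalAlgebra.adjoin F S).toSubmodule) (S₂ := sinkSpan F Γ L) hB

end Leavitt

/-! ### A graded representation on infinite paths. -/

namespace Leavitt

open Classical in
variable {V E : Type*} in
/-- The action of the generators on the functions of an infinite path and a degree. -/
noncomputable def genAct (F : Type*) [Field F] (Γ : DirGraph V E) :
    Gen V E → Module.End F (Stream' E × ℤ → F)
  | .vertex v =>
    { toFun ψ t := if Γ.IsInfPath t.1 ∧ Γ.s t.1.head = v then ψ t else 0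
      map_add' ψ φ := by ext t; simp only [Pi.add_apply]; split_ifs <;> simp
      map_smul' k ψ := by ext t; simp }
  | .edge e =>
    { toFun ψ t := if Γ.IsInfPath t.1 ∧ t.1.head = e then ψ (t.1.tail, t.2 - 1) else 0
      map_add' ψ φ := by ext t; simp only [Pi.add_apply]; split_ifs <;> simp
      map_smul' k ψ := by ext t; simp }
  | .ghost e =>
    { toFun ψ t := if Γ.IsInfPath (t.1.cons e) then ψ (t.1.cons e, t.2 + 1) else 0
      map_add' ψ φ := by ext t; simp only [Pi.add_apply]; split_ifs <;> simp
      map_smul' k ψ := by ext t; simp }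

variable (F : Type*) [Field F] {V E : Type*} (Γ : DirGraph V E)

/-- The representation of the free algebra extending `genAct`. -/
noncomputable def freeAct : Free F V E →ₙₐ[F] Module.End F (Stream' E × ℤ → F) :=
  MonoidAlgebra.liftMagma F (FreeSemigroup.lift (genAct F Γ))

theorem freeAct_of (g : Gen V E) :
    freeAct F Γ (MonoidAlgebra.single (FreeSemigroup.of g) 1) = genAct F Γ g := by
  simp [freeAct]

variable [Fintype E]

/-- On delta functions an edge prepends itself and raises the degree by one; a ghost edge deletes
the matching first edge and lowers it. Relation (iv) holds because an infinite path has exactly one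
first edge. The degree is needed since a lone loop fixes its own infinite path. -/
theorem freeAct_rel {a b : Free F V E} (h : Rel F Γ a b) : freeAct F Γ a = freeAct F Γ b := by
  classical
  induction h with
  | vertex_mul v w =>
    rw [map_mul, fv, fv, freeAct_of, freeAct_of]
    split_ifs with h
    · subst h
      rw [freeAct_of]
      ext ψ t
      simp only [genAct, Module.End.mul_apply, LinearMap.coe_mk, AddHom.coe_mk]
      split_ifs <;> rfl
    · rw [map_zero]
      ext ψ t
      simp only [genAct, Module.End.mul_apply, LinearMap.coe_mk, AddHom.coe_mk]
      split_ifs with h1 h2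
      · exact absurd (h1.2.symm.trans h2.2) h
      all_goals rfl
  | src_mul_edge e =>
    rw [map_mul, fv, fe, freeAct_of, freeAct_of]
    ext ψ t
    simp only [genAct, Module.End.mul_apply, LinearMap.coe_mk, AddHom.coe_mk]
    split_ifs with h1 h2 h2
    · rfl
    · rfl
    · exact absurd ⟨h2.1, by rw [h2.2]⟩ h1
    · rfl
  | edge_mul_rng e =>
    rw [map_mul, fv, fe, freeAct_of, freeAct_of]
    ext ψ t
    simp only [genAct, Module.End.mul_apply, LinearMap.coe_mk, AddHom.coe_mk]
    split_ifs with h1 h2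
    · rfl
    · have := DirGraph.isInfPath_tail h1.1
      exact absurd ⟨this.1, by rw [this.2, h1.2]⟩ h2
    · rfl
  | rng_mul_ghost e =>
    rw [map_mul, fv, fg, freeAct_of, freeAct_of]
    ext ψ t
    simp only [genAct, Module.End.mul_apply, LinearMap.coe_mk, AddHom.coe_mk,
      DirGraph.isInfPath_cons]
    split_ifs <;> rfl
  | ghost_mul_src e =>
    rw [map_mul, fv, fg, freeAct_of, freeAct_of]
    ext ψ t
    simp only [genAct, Module.End.mul_apply, LinearMap.coe_mk, AddHom.coe_mk,
      Stream'.head_cons, and_true]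
    split_ifs <;> rfl
  | ghost_mul_edge e f =>
    rw [map_mul, fe, fg, freeAct_of, freeAct_of]
    split_ifs with h
    · subst h
      rw [fv, freeAct_of]
      ext ψ t
      simp only [genAct, Module.End.mul_apply, LinearMap.coe_mk, AddHom.coe_mk,
        Stream'.head_cons, Stream'.tail_cons, and_true, add_sub_cancel_right,
        DirGraph.isInfPath_cons]
      split_ifs <;> rfl
    · rw [map_zero]
      ext ψ t
      simp only [genAct, Module.End.mul_apply, LinearMap.coe_mk, AddHom.coe_mk,
        Stream'.head_cons, h, and_false, if_false, ite_self]
      rfl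
  | vertex_eq_sum v hv =>
    rw [map_sum, fv, freeAct_of]
    ext ψ t
    have : ∀ e, freeAct F Γ (fe F e * fg F e) ψ t =
        if t.1.head = e then (if Γ.IsInfPath t.1 then ψ t else 0) else 0 := by
      intro e
      rw [map_mul, fe, fg, freeAct_of, freeAct_of]
      simp only [genAct, Module.End.mul_apply, LinearMap.coe_mk, AddHom.coe_mk]
      by_cases he : t.1.head = e
      · subst he
        by_cases ht : Γ.IsInfPath t.1 <;> simp [ht, Stream'.eta]
      · simp [he]
    rw [LinearMap.sum_apply, Finset.sum_apply, Finset.sum_congr rfl fun e _ => this e,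
      Finset.sum_ite_eq]
    simp only [genAct, LinearMap.coe_mk, AddHom.coe_mk, Finset.mem_filter, Finset.mem_univ,
      true_and]
    by_cases h1 : Γ.s t.1.head = v <;> by_cases ht : Γ.IsInfPath t.1 <;> simp [h1, ht]

/-- The representation of `L(Γ)` on the functions of an infinite path and a degree. -/
noncomputable def act : LPA F Γ →ₙₐ[F] Module.End F (Stream' E × ℤ → F) where
  toFun := Quotient.lift (freeAct F Γ) fun a b h => by
    -- The kernel of `freeAct` is one of the congruences whose infimum is `con`.
    have key : con F Γ ≤ RingCon.comap (⊥ : RingCon _) (freeAct F Γ) := by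
      refine sInf_le ⟨fun k a b h => ?_, fun a b h => freeAct_rel F Γ h⟩
      change freeAct F Γ _ = freeAct F Γ _
      rw [map_smul, map_smul]
      exact congrArg (k • ·) h
    exact key h
  map_smul' k x := by
    obtain ⟨a, rfl⟩ := mk_surjective F Γ x
    exact map_smul (freeAct F Γ) k a
  map_zero' := map_zero (freeAct F Γ)
  map_add' x y := by
    obtain ⟨a, rfl⟩ := mk_surjective F Γ x
    obtain ⟨b, rfl⟩ := mk_surjective F Γ y
    exact map_add (freeAct F Γ) a b
  map_mul' x y := by
    obtain ⟨a, rfl⟩ := mk_surjective F Γ x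
    obtain ⟨b, rfl⟩ := mk_surjective F Γ y
    exact map_mul (freeAct F Γ) a b

theorem act_vertex (v : V) : act F Γ (vertex F Γ v) = genAct F Γ (.vertex v) :=
  freeAct_of F Γ _

theorem act_edge (e : E) : act F Γ (edge F Γ e) = genAct F Γ (.edge e) :=
  freeAct_of F Γ _

end Leavitt

/-- Vectors that are triangular with respect to a sequence of functionals are independent. -/
theorem linearIndependent_of_triangular {F M : Type*} [Field F] [AddCommGroup M] [Module F M]
    (b : ℕ → M) (φ : ℕ → M →ₗ[F] F) (h0 : ∀ i j, i < j → φ i (b j) = 0)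
    (h1 : ∀ i, φ i (b i) ≠ 0) : LinearIndependent F b := by
  rw [linearIndependent_iff']
  intro s g hg i
  induction i using Nat.strong_induction_on with
  | _ i ih =>
    intro hi
    have h := congrArg (φ i) hg
    rw [map_sum, map_zero, Finset.sum_eq_single i] at h
    · rw [map_smul, smul_eq_mul] at h
      exact (mul_eq_zero.1 h).resolve_right (h1 i)
    · intro j hj hji
      rcases lt_or_gt_of_ne hji with hlt | hgt
      · rw [ih j hlt hj, zero_smul, map_zero]
      · rw [map_smul, h0 i j hgt, smul_zero]
    · exact fun h => absurd hi h

/-! ### Degrees and leading coefficients. -/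

namespace Leavitt

variable {F : Type*} [Field F] {V E : Type*}

variable (F E) in
/-- The functions that vanish in the degrees less than `d`. -/
def degreeGE (d : ℤ) : Submodule F (Stream' E × ℤ → F) where
  carrier := {ψ | ∀ x n, n < d → ψ (x, n) = 0}
  zero_mem' _ _ _ := rfl
  add_mem' h1 h2 x n hn := by simp [h1 x n hn, h2 x n hn]
  smul_mem' k _ h x n hn := by simp [h x n hn]

theorem degreeGE_anti {c d : ℤ} (h : c ≤ d) : degreeGE F E d ≤ degreeGE F E c :=
  fun _ hψ x n hn => hψ x n (hn.trans_le h)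

variable [Fintype E] {Γ : DirGraph V E}

theorem act_pathTo_mem {ψ : Stream' E × ℤ → F} {d : ℤ} (hψ : ψ ∈ degreeGE F E d) (p : List E)
    (w : V) : act F Γ (pathTo F Γ p w) ψ ∈ degreeGE F E (d + p.length) := by
  classical
  induction p with
  | nil =>
    intro x n hn
    rw [pathTo, act_vertex]
    simp only [genAct, LinearMap.coe_mk, AddHom.coe_mk]
    rw [hψ x n (by simpa using hn), ite_self]
  | cons e p ih =>
    intro x n hn
    rw [pathTo, map_mul, act_edge]
    simp only [genAct, Module.End.mul_apply, LinearMap.coe_mk, AddHom.coe_mk]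
    rw [ih _ _ (by simp at hn; omega), ite_self]

/-- The witness is `c` followed by `x`. It does not depend on `ψ`, so evaluation there reads off the
leading coefficient of any function. -/
theorem exists_act_pathTo_apply {v u : V} {c : List E} (hc : Γ.IsPath v c u) {x : Stream' E}
    (hx : Γ.IsInfPath x) (hxu : Γ.s x.head = u) : ∃ x', (Γ.IsInfPath x' ∧ Γ.s x'.head = v) ∧
      ∀ (ψ : Stream' E × ℤ → F) (d : ℤ),
        act F Γ (pathTo F Γ c u) ψ (x', d + c.length) = ψ (x, d) := by
  induction c generalizing v with
  | nil =>
    obtain rfl : v = u := hc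
    refine ⟨x, ⟨hx, hxu⟩, fun ψ d => ?_⟩
    rw [pathTo, act_vertex]
    simp [genAct, hx, hxu]
  | cons e c ih =>
    obtain ⟨x', ⟨h1, h2⟩, h3⟩ := ih hc.2
    refine ⟨x'.cons e, ⟨DirGraph.isInfPath_cons.2 ⟨h1, h2⟩, hc.1⟩, fun ψ d => ?_⟩
    rw [pathTo, map_mul, act_edge, ← h3 ψ d]
    simp only [genAct, Module.End.mul_apply, LinearMap.coe_mk, AddHom.coe_mk]
    rw [if_pos ⟨DirGraph.isInfPath_cons.2 ⟨h1, h2⟩, rfl⟩, Stream'.tail_cons,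
      show d + ((e :: c).length : ℤ) - 1 = d + c.length by push_cast [List.length_cons]; ring]

variable (F Γ) in
/-- The span of the paths of length at least `m` that end at `w`. -/
noncomputable def pathSpan (m : ℕ) (w : V) : Submodule F (LPA F Γ) :=
  Submodule.span F {x | ∃ p : List E, m ≤ p.length ∧ pathTo F Γ p w = x}

theorem pathTo_mem_pathSpan {m : ℕ} {p : List E} (hp : m ≤ p.length) (w : V) :
    pathTo F Γ p w ∈ pathSpan F Γ m w :=
  Submodule.subset_span ⟨p, hp, rfl⟩

theorem act_mem_of_mem_pathSpan {m : ℕ} {w : V} {h : LPA F Γ} (hh : h ∈ pathSpan F Γ m w)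
    {ψ : Stream' E × ℤ → F} {d : ℤ} (hψ : ψ ∈ degreeGE F E d) :
    act F Γ h ψ ∈ degreeGE F E (d + m) := by
  induction hh using Submodule.span_induction with
  | mem x hx =>
    obtain ⟨p, hp, rfl⟩ := hx
    exact degreeGE_anti (by omega) (act_pathTo_mem hψ p w)
  | zero => rw [map_zero]; exact zero_mem _
  | add x y _ _ h1 h2 => rw [map_add]; exact add_mem h1 h2
  | smul k x _ h => rw [map_smul]; exact Submodule.smul_mem _ _ h

/-! ### Locally finite dimensional ideals lie in `I₀`. -/

/-- Every element of `L(Γ)` maps long paths to combinations of long paths. -/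
theorem exists_mul_pathTo_mem (x : LPA F Γ) (m : ℕ) :
    ∃ n, ∀ (q : List E) (w : V), n ≤ q.length → x * pathTo F Γ q w ∈ pathSpan F Γ m w := by
  induction x using LPA.induction generalizing m with
  | vertex v =>
    refine ⟨m, fun q w hq => ?_⟩
    rcases vertex_mul_pathTo (F := F) (Γ := Γ) v q w with h | h <;> rw [h]
    exacts [pathTo_mem_pathSpan hq w, zero_mem _]
  | edge e => exact ⟨m, fun q w hq => pathTo_mem_pathSpan (p := e :: q) (hq.trans (by simp)) w⟩
  | ghost e =>
    -- A ghost edge shortens a path by one edge.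
    refine ⟨m + 1, fun q w hq => ?_⟩
    cases q with
    | nil => simp at hq
    | cons f q =>
      rcases ghost_mul_pathTo_cons (F := F) (Γ := Γ) e f q w with h | h <;> rw [h]
      exacts [pathTo_mem_pathSpan (by simpa using hq) w, zero_mem _]
  | zero => exact ⟨0, fun q w _ => by rw [zero_mul]; exact zero_mem _⟩
  | add x y hx hy =>
    obtain ⟨a, ha⟩ := hx m
    obtain ⟨b, hb⟩ := hy m
    refine ⟨max a b, fun q w hq => ?_⟩
    rw [add_mul]
    exact add_mem (ha q w ((le_max_left _ _).trans hq)) (hb q w ((le_max_right _ _).trans hq))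
  | smul k x hx =>
    obtain ⟨a, ha⟩ := hx m
    refine ⟨a, fun q w hq => ?_⟩
    rw [smul_mul_assoc]
    exact Submodule.smul_mem _ _ (ha q w hq)
  | mul x y hx hy =>
    obtain ⟨a, ha⟩ := hx m
    -- The paths produced by `y` must be long enough for `x`, hence the induction for all `m`.
    obtain ⟨b, hb⟩ := hy a
    refine ⟨b, fun q w hq => ?_⟩
    rw [mul_assoc]
    refine mul_mem_of_mem_span ?_ (hb q w hq)
    rintro _ ⟨p, hp, rfl⟩
    exact ha p w hp

theorem mul_sum_vertex [Fintype V] (x : LPA F Γ) : x * ∑ v, vertex F Γ v = x := by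
  have key : ∀ (x : LPA F Γ) (v : V), x * vertex F Γ v = x → x * ∑ v, vertex F Γ v = x := by
    intro x v h
    rw [Finset.mul_sum, Finset.sum_eq_single v, h]
    · intro w _ hw
      rw [← h, mul_assoc, vertex_mul_of_ne F Γ hw.symm, mul_zero]
    · simp
  induction x using LPA.induction with
  | vertex v => exact key _ v (vertex_mul_self F Γ v)
  | edge e => exact key _ _ (edge_mul_rng F Γ e)
  | ghost e => exact key _ _ (ghost_mul_src F Γ e)
  | zero => rw [zero_mul]
  | add x y hx hy => rw [add_mul, hx, hy]
  | smul k x hx => rw [smul_mul_assoc, hx]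
  | mul x y _ hy => rw [mul_assoc, hy]

theorem pathTo_mem_I₀ {q : List E} {w : V} (hw : w ∈ Γ.V₀) : pathTo F Γ q w ∈ I₀ F Γ := by
  rw [← pathTo_mul_vertex]
  exact (isAlgIdeal_algIdealSpan F _ _ _
    (subset_algIdealSpan F _ (Set.mem_image_of_mem _ hw))).1

/-- If `x q` is outside `I₀`, the endpoint of `q` is outside `V₀`, so it emits edges. By (iv), `x q`
is the sum of the `x q f f*`, so some `x q f` is outside `I₀`. -/
theorem exists_mul_pathTo_notMem [Fintype V] {x : LPA F Γ} (hx : x ∉ I₀ F Γ) (n : ℕ) :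
    ∃ (q : List E) (w : V), q.length = n ∧ x * pathTo F Γ q w ∉ I₀ F Γ := by
  classical
  have hI : IsAlgIdeal F (I₀ F Γ) := isAlgIdeal_algIdealSpan F _
  induction n with
  | zero =>
    by_contra! h
    refine hx ?_
    rw [← mul_sum_vertex x, Finset.mul_sum]
    exact sum_mem fun v _ => h [] v rfl
  | succ n ih =>
    obtain ⟨q, w, rfl, hq⟩ := ih
    have hw : w ∉ Γ.V₀ := fun hw => hq (hI _ _ (pathTo_mem_I₀ hw)).1
    obtain ⟨e, he, -⟩ := DirGraph.exists_edge_of_notMem_V₀ hw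
    by_contra! h
    refine hq ?_
    rw [← pathTo_mul_vertex, vertex_eq_sum F Γ ⟨e, he⟩, Finset.mul_sum, Finset.mul_sum]
    refine sum_mem fun f hf => ?_
    have hfw : Γ.s f = w := (Finset.mem_filter.1 hf).2
    have hp : pathTo F Γ q w * edge F Γ f = pathTo F Γ (q ++ [f]) (Γ.r f) := by
      rw [← pathTo_mul_pathTo (show Γ.IsPath w [f] (Γ.r f) from ⟨hfw, rfl⟩), pathTo, pathTo, edge_mul_rng]
    rw [← mul_assoc (pathTo F Γ q w), hp, ← mul_assoc]
    exact (hI _ _ (h (q ++ [f]) (Γ.r f) (by simp))).2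

/-- A nonzero combination of paths to `w` is turned by a ghost path into a combination of paths
to `w` in which the vertex `w` occurs. -/
theorem exists_ghostFrom_mul_eq {w : V} {y : LPA F Γ} (hy : y ∈ pathSpan F Γ 0 w) (hy0 : y ≠ 0) :
    ∃ (p : List E) (k : F), k ≠ 0 ∧ ∃ h ∈ pathSpan F Γ 1 w,
      ghostFrom F Γ p w * y = k • vertex F Γ w + h := by
  classical
  have hr : {x | ∃ p : List E, 0 ≤ p.length ∧ pathTo F Γ p w = x} =
      Set.range fun p => pathTo F Γ p w := by
    ext x; simp
  rw [pathSpan, hr, Finsupp.mem_span_range_iff_exists_finsupp] at hy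
  obtain ⟨k, rfl⟩ := hy
  let s := k.support.filter fun p => pathTo F Γ p w ≠ 0
  have hs : s.Nonempty := by
    by_contra hs
    refine hy0 (Finset.sum_eq_zero fun p hp => ?_)
    rw [Finset.not_nonempty_iff_eq_empty, Finset.filter_eq_empty_iff] at hs
    simp only [not_not.1 (hs hp), smul_zero]
  -- With `p` shortest among the nonzero terms, `p*` turns every other term into zero or a path of
  -- positive length.
  obtain ⟨p, hp, hmin⟩ := s.exists_min_image List.length hs
  obtain ⟨hpk, hp0⟩ := Finset.mem_filter.1 hp
  obtain ⟨v, hv⟩ := exists_isPath_of_pathTo_ne_zero hp0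
  refine ⟨p, k p, Finsupp.mem_support_iff.1 hpk,
    ghostFrom F Γ p w * ∑ q ∈ k.support.erase p, k q • pathTo F Γ q w, ?_, ?_⟩
  · rw [Finset.mul_sum]
    refine sum_mem fun q hq => ?_
    rw [mul_smul_comm]
    refine Submodule.smul_mem _ _ ?_
    obtain ⟨hqp, hqk⟩ := Finset.mem_erase.1 hq
    by_cases hq0 : pathTo F Γ q w = 0
    · rw [hq0, mul_zero]; exact zero_mem _
    · rcases ghostFrom_mul_pathTo_of_ne (F := F) (Γ := Γ) w w
        (hmin q (Finset.mem_filter.2 ⟨hqk, hq0⟩)) hqp.symm with h | ⟨p', hp', h⟩ <;> rw [h]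
      exacts [zero_mem _, pathTo_mem_pathSpan hp' w]
  · rw [Finsupp.sum, ← Finset.add_sum_erase _ _ hpk, mul_add, mul_smul_comm,
      ghostFrom_mul_pathTo_self hv]

/-- The paths in `h g` are longer than `g`, so cancelling against `g*` leaves positive length. -/
theorem ghostFrom_mul_mul_pathTo_mem {w u : V} {g : List E} (hg : Γ.IsPath w g u) {h : LPA F Γ}
    (hh : h ∈ pathSpan F Γ 1 w) :
    ghostFrom F Γ g u * h * pathTo F Γ g u ∈ pathSpan F Γ 1 u := by
  rw [mul_assoc]
  have h1 : h * pathTo F Γ g u ∈ pathSpan F Γ (g.length + 1) u := by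
    refine mul_mem_of_mem_span_left ?_ hh
    rintro _ ⟨p, hp, rfl⟩
    rw [pathTo_mul_pathTo hg]
    exact pathTo_mem_pathSpan (by simp; omega) u
  refine mul_mem_of_mem_span ?_ h1
  rintro _ ⟨p, hp, rfl⟩
  rcases ghostFrom_mul_pathTo_of_ne (F := F) (Γ := Γ) u u (q := g) (p := p) (by omega)
    (by rintro rfl; omega) with h | ⟨p', hp', h⟩ <;> rw [h]
  exacts [zero_mem _, pathTo_mem_pathSpan hp' u]

/-- An element that raises the degree and has a nonzero leading coefficient generates an
infinite dimensional algebra. -/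
theorem not_finiteDimensional_adjoin {a : LPA F Γ} {l : ℕ} (hl : 0 < l) {k : F} (hk : k ≠ 0)
    (X : ℕ → Stream' E)
    (hdeg : ∀ d, ∀ ψ ∈ degreeGE F E d, act F Γ a ψ ∈ degreeGE F E (d + l))
    (hlead : ∀ n d, ∀ ψ ∈ degreeGE F E d, act F Γ a ψ (X (n + 1), d + l) = k * ψ (X n, d)) :
    ¬ FiniteDimensional F (NonUnitalAlgebra.adjoin F {a}) := by
  intro hfd
  let B := NonUnitalAlgebra.adjoin F {a}
  let a' : B := ⟨a, NonUnitalAlgebra.subset_adjoin F rfl⟩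
  -- `b n` is the power of `a` with exponent `n + 1`; there need be no unit to start from.
  let b : ℕ → B := fun n => (a' * ·)^[n] a'
  have hb0 : ((b 0 : B) : LPA F Γ) = a := rfl
  have hb : ∀ n, ((b (n + 1) : B) : LPA F Γ) = a * (b n : LPA F Γ) := fun n => by
    simp only [b, Function.iterate_succ_apply']; rfl
  let ψ₀ : Stream' E × ℤ → F := fun t => if t.2 = 0 then 1 else 0
  have hψ₀ : ψ₀ ∈ degreeGE F E 0 := fun x n hn => if_neg hn.ne
  have hmem : ∀ n : ℕ, act F Γ (b n) ψ₀ ∈ degreeGE F E ((n + 1) * l) := by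
    intro n
    induction n with
    | zero => simpa [hb0] using hdeg 0 ψ₀ hψ₀
    | succ n ih =>
      have h := hdeg _ _ ih
      rw [hb, map_mul, Module.End.mul_apply]
      rwa [show ((n : ℤ) + 1) * l + l = ((n + 1 : ℕ) + 1) * l by push_cast; ring] at h
  have hval : ∀ n : ℕ, act F Γ (b n) ψ₀ (X (n + 1), (n + 1) * l) = k ^ (n + 1) := by
    intro n
    induction n with
    | zero =>
      have := hlead 0 0 ψ₀ hψ₀
      simpa [ψ₀, hb0] using this
    | succ n ih =>
      rw [hb, map_mul, pow_succ', ← ih, ← hlead (n + 1) _ _ (hmem n)]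
      rw [Module.End.mul_apply,
        show ((n : ℤ) + 1) * l + l = ((n + 1 : ℕ) + 1) * l by push_cast; ring]
  -- `φ n` reads the lowest possible degree of `b n` applied to `ψ₀`, where the value is `k ^ (n +
  -- 1)`; later powers vanish there.
  let φ : ℕ → B →ₗ[F] F := fun n =>
    { toFun x := act F Γ x ψ₀ (X (n + 1), (n + 1) * l)
      map_add' x y := by simp
      map_smul' c x := by simp }
  have hind : LinearIndependent F b := by
    refine linearIndependent_of_triangular b φ (fun i j hij => hmem j _ _ ?_) fun i => ?_
    · have : (i : ℤ) < j := by exact_mod_cast hij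
      have : (0 : ℤ) < l := by exact_mod_cast hl
      nlinarith
    · change act F Γ (b i) ψ₀ (X (i + 1), (i + 1) * l) ≠ 0
      rw [hval]
      exact pow_ne_zero _ hk
  have : Finite ℕ := hind.finite
  exact not_finite ℕ

theorem le_I₀_of_isLocallyFiniteDimensional [Fintype V] {J : Submodule F (LPA F Γ)}
    (hJ : IsAlgIdeal F J) (hfd : IsLocallyFiniteDimensional F J) : J ≤ I₀ F Γ := by
  intro x hx
  by_contra hx₀
  -- For paths `q` of length `n` the product `x q` contains no ghost edges.
  obtain ⟨n, hn⟩ := exists_mul_pathTo_mem x 0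
  obtain ⟨q, w, hq, hy⟩ := exists_mul_pathTo_notMem hx₀ n
  have hw : w ∉ Γ.V₀ := fun hw => hy (isAlgIdeal_algIdealSpan F _ _ _ (pathTo_mem_I₀ hw)).1
  obtain ⟨p, k, hk, h, hh, hz⟩ := exists_ghostFrom_mul_eq (hn q w hq.ge)
    fun h0 => hy (h0 ▸ zero_mem _)
  obtain ⟨g, u, c, hg, hc, hcu, hu⟩ := DirGraph.exists_closed_of_notMem_V₀ hw
  set h' := ghostFrom F Γ g u * h * pathTo F Γ g u with hh'
  have hh'm : h' ∈ pathSpan F Γ 1 u := ghostFrom_mul_mul_pathTo_mem hg hh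
  set a := k • pathTo F Γ c u + pathTo F Γ c u * h' with ha
  have haJ : a ∈ J := by
    have : a = pathTo F Γ c u * (ghostFrom F Γ g u * (ghostFrom F Γ p w *
        (x * pathTo F Γ q w)) * pathTo F Γ g u) := by
      rw [hz, mul_add, add_mul, mul_add, mul_smul_comm, smul_mul_assoc, mul_smul_comm,
        mul_assoc _ (vertex F Γ w), src_mul_pathTo hg, ghostFrom_mul_pathTo_self hg,
        pathTo_mul_vertex]
    rw [this]
    exact (hJ _ _ (hJ _ _ (hJ _ _ (hJ _ _ (hJ _ _ hx).2).1).1).2).1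
  have hact : ∀ ψ, act F Γ a ψ = k • act F Γ (pathTo F Γ c u) ψ +
      act F Γ (pathTo F Γ c u) (act F Γ h' ψ) := by
    intro ψ
    rw [ha, map_add, map_smul, map_mul]; rfl
  obtain ⟨x₀, hx₀, hx₀u⟩ := DirGraph.exists_isInfPath hu
  have hex : ∀ x : {x // Γ.IsInfPath x ∧ Γ.s x.head = u}, ∃ x',
      (Γ.IsInfPath x' ∧ Γ.s x'.head = u) ∧ ∀ (ψ : Stream' E × ℤ → F) (d : ℤ),
        act F Γ (pathTo F Γ c u) ψ (x', d + c.length) = ψ (x, d) :=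
    fun x => exists_act_pathTo_apply hcu x.2.1 x.2.2
  choose f hf hf' using hex
  -- `X n` is `x₀` preceded by `n` copies of `c`.
  let X : ℕ → {x // Γ.IsInfPath x ∧ Γ.s x.head = u} :=
    fun n => (fun x => ⟨f x, hf x⟩)^[n] ⟨x₀, hx₀, hx₀u⟩
  have hX : ∀ n, (X (n + 1)).1 = f (X n) := fun n => by
    simp only [X, Function.iterate_succ_apply']
  refine not_finiteDimensional_adjoin (a := a) (l := c.length) (List.length_pos_iff.2 hc) hk
    (fun n => (X n).1) (fun d ψ hψ => ?_) (fun n d ψ hψ => ?_)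
    (hfd {a} (Set.finite_singleton a) (Set.singleton_subset_iff.2 haJ))
  · rw [hact]
    exact add_mem (Submodule.smul_mem _ _ (act_pathTo_mem hψ c u))
      (act_pathTo_mem (degreeGE_anti (by simp) (act_mem_of_mem_pathSpan hh'm hψ)) c u)
  · rw [hact, hX]
    simp only [Pi.add_apply, Pi.smul_apply, smul_eq_mul, hf']
    -- Since `h'` raises degrees by at least one, `c h'` contributes nothing in degree `d +
    -- c.length`.
    rw [act_mem_of_mem_pathSpan hh'm hψ _ _ (by simp), add_zero]

end Leavitt

theorem lemma5 {F V E : Type*} [Field F] [Fintype V] [Fintype E] (Γ : DirGraph V E)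
    (hΓ : Γ.NoDistinctIntersectingCycles) :
    Leavitt.I₀ F Γ = Loc F (Leavitt.LPA F Γ) :=
  le_antisymm
    (le_sSup ⟨isAlgIdeal_algIdealSpan F _, Leavitt.isLocallyFiniteDimensional_I₀⟩)
    (sSup_le fun _ hJ => Leavitt.le_I₀_of_isLocallyFiniteDimensional hJ.1 hJ.2)
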